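/- **Setting.** Fix $\hbar\in(0,1]$ and a sequence $(q_j)_{j\ge 1}$ of positive real numbers with $\sum_j q_j^2<\infty$. For $g\in\mathcal S(\mathbb R^n)$ and $u\in\mathcal S'(\mathbb R^n)$ let $$V_g u(x,\xi)=\langle u,M_\xi T_x g\rangle,\qquad M_\xi T_x g(y)=(2\pi\hbar)^{-n/2}e^{\frac{i}{\hbar}\xi\cdot y}g(y-x),\qquad \langle u,\varphi\rangle=u(\overline{\varphi}),$$ and $$\|u\|_{M^{\infty,1}_{(g)}(\mathbb R^n)}=\int_{\mathbb R^n}\sup_{x\in\mathbb R^n}|V_gu(x,\xi)|\,d\xi .$$ The space $M^{\infty,1}(\mathbb R^n)$ consists of all $u\in\mathcal S'(\mathbb R^n)$ for which this is finite for some $g\in\mathcal S(\mathbb R^n)\setminus\{0\}$; its elements are identified with the bounded continuous functions representing them. Let $$g_n(x)=(2\pi\hbar)^{-n/2}\exp\Big(-\frac1{2\hbar}\sum_{j=1}^n q_jx_j^2\Big),\qquad x\in\mathbb R^n.$$ Let $\mathbb R^\infty=\mathbb R^{\mathbb N}$ be the space of all real sequences, $\pi_n:\mathbb R^\infty\to\mathbb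 R^n$ the projection onto the first $n$ coordinates, and $\mathcal E_nf=f\circ\pi_n$ for $f:\mathbb R^n\to\mathbb C$. Let $$\mathcal C_0=\bigcup_n\mathcal E_nM^{\infty,1}(\mathbb R^n)$$ be the space of cylinder functions $\mathbb R^\infty\to\mathbb C$, with the norm $\|\mathcal E_nf\|:=\|f\|_{M^{\infty,1}_{(g_n)}(\mathbb R^n)}$ (which does not depend on the representation of the cylinder function). Let $D(L)$ be the closure (abstract completion) of $\mathcal C_0$ in this norm: its elements are the equivalence classes of Cauchy sequences $(f_n)_{n}$ in $\mathcal C_0$, where $(f_n)\sim(f_n')$ means $\|f_n-f_n'\|\to0$. **Corollary 5.6.** Let $f\in D(L)$. For every sequence $(f_n)$ in the equivalence class $f$ and every $x\in\mathbb R^\infty$, the limit $\lim_{n\to\infty}f_n(x)$ exists and is finite. If $(f_n)$ and $(f_n')$ are two sequences in the equivalence class $f$, then $\lim_{n\to\infty} f_n(x)=\lim_{n\to\infty} f_n'(x)$ for every $x\in\mathbb R^\infty$. Hence there is exactly one function $\mathbb R^\infty\to\mathbb C$, again denoted by $f$, such that $f(x)=\lim_{n\to\infty}f_n(x)$ for every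 $x\in\mathbb R^\infty$ and every representative $(f_n)$ of $f$. -/

import Mathlib

open MeasureTheory Filter Topology
open scoped SchwartzMap ENNReal

namespace Fresnel

/-- `ℝⁿ` with its Euclidean structure. -/
abbrev E (n : ℕ) : Type := EuclideanSpace ℝ (Fin n)

/-! ### Auxiliary facts: plane waves have temperate growth, Gaussians are Schwartz functions -/

theorem hasTemperateGrowth_cexp_I :
    Function.HasTemperateGrowth (fun t : ℝ => Complex.exp (Complex.I * t)) := by
  have hd : ∀ n : ℕ, iteratedDeriv n (fun t : ℝ => Complex.exp (Complex.I * t)) =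
      fun t : ℝ => Complex.I ^ n * Complex.exp (Complex.I * t) := by
    intro n
    induction n with
    | zero => simp
    | succ n ih =>
      rw [iteratedDeriv_succ, ih]
      funext t
      have h1 : HasDerivAt (fun t : ℝ => Complex.exp (Complex.I * t))
          (Complex.exp (Complex.I * t) * (Complex.I * 1)) t :=
        ((Complex.ofRealCLM.hasDerivAt (x := t)).const_mul Complex.I).cexp
      rw [(h1.const_mul (Complex.I ^ n)).deriv]
      ring
  refine ⟨(contDiff_const.mul Complex.ofRealCLM.contDiff).cexp, fun n => ⟨0, 1, fun t => ?_⟩⟩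
  rw [norm_iteratedFDeriv_eq_norm_iteratedDeriv, hd, norm_mul, mul_comm Complex.I,
    Complex.norm_exp_ofReal_mul_I]
  simp

theorem hasTemperateGrowth_wave {n : ℕ} (ħ c : ℝ) (ξ : E n) :
    Function.HasTemperateGrowth
      (fun y : E n => (c : ℂ) * Complex.exp (Complex.I / ħ * (inner ℝ ξ y : ℝ))) := by
  have h : Function.HasTemperateGrowth (fun y : E n => ħ⁻¹ * inner ℝ ξ y) :=
    (Function.HasTemperateGrowth.const _).mul (by fun_prop)
  have h2 := (Function.HasTemperateGrowth.const (E := E n) (c : ℂ)).mul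
    (hasTemperateGrowth_cexp_I.comp h)
  have he : (fun y : E n => (c : ℂ) * Complex.exp (Complex.I / ħ * (inner ℝ ξ y : ℝ))) =
      (fun _ => (c : ℂ)) * ((fun t : ℝ => Complex.exp (Complex.I * t)) ∘
        fun y : E n => ħ⁻¹ * inner ℝ ξ y) := by
    funext y
    simp only [Pi.mul_apply, Function.comp_apply]
    congr 2
    push_cast
    ring
  rw [he]
  exact h2

/-- The function `exp (-p)` is a Schwartz function if `p` has temperate growth and dominates
a positive multiple of `‖x‖ ^ 2`. -/
theorem exp_neg_decay {n : ℕ} {p : E n → ℝ} (hp : Function.HasTemperateGrowth p) {a : ℝ}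
    (ha : 0 < a) (hpa : ∀ x, a * ‖x‖ ^ 2 ≤ p x) (k m : ℕ) :
    ∃ C : ℝ, ∀ x, ‖x‖ ^ k * ‖iteratedFDeriv ℝ m (fun x => Real.exp (-p x)) x‖ ≤ C := by
  obtain ⟨l, C, hC0, hC⟩ := hp.norm_iteratedFDeriv_le_uniform m
  have hexp : ∀ (i : ℕ) (t : ℝ),
      ‖iteratedFDeriv ℝ i (fun t : ℝ => Real.exp ((-1) * t)) t‖ ≤ Real.exp (-t) := by
    intro i t
    rw [norm_iteratedFDeriv_eq_norm_iteratedDeriv, iteratedDeriv_exp_const_mul]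
    simp
  have hbound : ∀ x : E n, ‖iteratedFDeriv ℝ m (fun x => Real.exp (-p x)) x‖ ≤
      m.factorial * Real.exp (-(a * ‖x‖ ^ 2)) * ((1 + C) * (1 + ‖x‖) ^ l) ^ m := by
    intro x
    have hx1 : 1 ≤ (1 + ‖x‖) ^ l := one_le_pow₀ (by linarith [norm_nonneg x])
    have h := norm_iteratedFDeriv_comp_le (𝕜 := ℝ) (g := fun t : ℝ => Real.exp ((-1) * t))
      (f := p) (n := m) (N := (⊤ : ℕ∞)) (by fun_prop) hp.1 (by exact_mod_cast le_top) x
      (C := Real.exp (-(a * ‖x‖ ^ 2))) (D := (1 + C) * (1 + ‖x‖) ^ l)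
      (fun i _ => (hexp i (p x)).trans (Real.exp_le_exp.2 (by linarith [hpa x])))
      (fun i hi him => by
        refine (hC i him x).trans ?_
        have h1 : C * (1 + ‖x‖) ^ l ≤ (1 + C) * (1 + ‖x‖) ^ l := by nlinarith
        have h2 : 1 ≤ (1 + C) * (1 + ‖x‖) ^ l := by nlinarith
        exact h1.trans (le_self_pow₀ h2 (by omega)))
    have he : (fun t : ℝ => Real.exp ((-1) * t)) ∘ p = fun x => Real.exp (-p x) := by
      funext y; simp
    rwa [he] at h
  -- it remains to bound a polynomial times a Gaussian
  set N : ℕ := k + l * m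
  have hlim : Tendsto (fun r : ℝ => (1 + r) ^ N * Real.exp (-a * r)) atTop (𝓝 0) := by
    have h := (Real.tendsto_pow_mul_exp_neg_atTop_nhds_zero N).comp
      ((tendsto_id.const_mul_atTop ha).comp (tendsto_atTop_add_const_left atTop 1 tendsto_id))
    have h' := (h.mul_const (Real.exp a * (a⁻¹) ^ N))
    rw [zero_mul] at h'
    refine h'.congr fun r => ?_
    simp only [Function.comp_apply, id_eq]
    rw [mul_pow, show -(a * (1 + r)) = -a + -a * r by ring, Real.exp_add, Real.exp_neg, inv_pow]
    have : Real.exp a ≠ 0 := (Real.exp_pos a).ne'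
    field_simp
  obtain ⟨B, hB⟩ : ∃ B : ℝ, ∀ r : ℝ, 0 ≤ r → (1 + r) ^ N * Real.exp (-a * r) ≤ B := by
    obtain ⟨R, hR⟩ := eventually_atTop.1 (hlim.eventually (gt_mem_nhds one_pos))
    obtain ⟨B, hB⟩ := (isCompact_Icc (a := (0 : ℝ)) (b := R)).bddAbove_image
      (f := fun r : ℝ => (1 + r) ^ N * Real.exp (-a * r)) (by fun_prop)
    refine ⟨max B 1, fun r hr => ?_⟩
    rcases le_total r R with h | h
    · exact (hB ⟨r, ⟨hr, h⟩, rfl⟩).trans (le_max_left _ _)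
    · exact (hR r h).le.trans (le_max_right _ _)
  refine ⟨m.factorial * (1 + C) ^ m * (Real.exp a * B), fun x => ?_⟩
  have hx := norm_nonneg x
  have hB' := hB ‖x‖ hx
  have hg : Real.exp (-(a * ‖x‖ ^ 2)) ≤ Real.exp a * Real.exp (-a * ‖x‖) := by
    rw [← Real.exp_add]
    exact Real.exp_le_exp.2 (by nlinarith [sq_nonneg (‖x‖ - 1)])
  calc ‖x‖ ^ k * ‖iteratedFDeriv ℝ m (fun x => Real.exp (-p x)) x‖
      ≤ (1 + ‖x‖) ^ k * (m.factorial * (Real.exp a * Real.exp (-a * ‖x‖)) *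
          ((1 + C) * (1 + ‖x‖) ^ l) ^ m) := by
        gcongr
        · linarith
        · refine (hbound x).trans ?_
          gcongr
    _ = m.factorial * (1 + C) ^ m * (Real.exp a * ((1 + ‖x‖) ^ N * Real.exp (-a * ‖x‖))) := by
        rw [mul_pow, ← pow_mul, pow_add]; ring
    _ ≤ _ := by gcongr

/-! ### Windows, phase space shifts and the short-time Fourier transform -/

/-- The quadratic form `(1 / 2ħ) ⟨x, Qₙ x⟩` with `Qₙ = diag (q₁, …, qₙ)`. -/
noncomputable def quadForm (ħ : ℝ) (q : ℕ → ℝ) (n : ℕ) (x : E n) : ℝ :=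
  1 / (2 * ħ) * ∑ j : Fin n, q j * x j ^ 2

theorem quadForm_hasTemperateGrowth (ħ : ℝ) (q : ℕ → ℝ) (n : ℕ) :
    Function.HasTemperateGrowth (quadForm ħ q n) := by
  have hc : ∀ j : Fin n, Function.HasTemperateGrowth (fun x : E n => x j) := fun j =>
    (EuclideanSpace.proj j : E n →L[ℝ] ℝ).hasTemperateGrowth
  exact (Function.HasTemperateGrowth.const _).mul
    (Function.HasTemperateGrowth.sum fun j _ =>
      (Function.HasTemperateGrowth.const _).mul ((hc j).pow 2))

theorem exists_le_quadForm {ħ : ℝ} (hħ : 0 < ħ) {q : ℕ → ℝ} (hq : ∀ j, 0 < q j) (n : ℕ) :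
    ∃ a : ℝ, 0 < a ∧ ∀ x, a * ‖x‖ ^ 2 ≤ quadForm ħ q n x := by
  obtain ⟨b, hb, hbq⟩ : ∃ b : ℝ, 0 < b ∧ ∀ j : Fin n, b ≤ q j := by
    rcases isEmpty_or_nonempty (Fin n) with h | h
    · exact ⟨1, one_pos, fun j => h.elim j⟩
    · obtain ⟨i, hi⟩ := Finite.exists_min fun j : Fin n => q j
      exact ⟨q i, hq i, hi⟩
  refine ⟨1 / (2 * ħ) * b, by positivity, fun x => ?_⟩
  rw [EuclideanSpace.norm_sq_eq, quadForm, mul_assoc, Finset.mul_sum]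
  refine mul_le_mul_of_nonneg_left (Finset.sum_le_sum fun j _ => ?_) (by positivity)
  rw [Real.norm_eq_abs, sq_abs]
  exact mul_le_mul_of_nonneg_right (hbq j) (sq_nonneg _)

/-- The Gaussian window `gₙ(x) = (2πħ)^{-n/2} exp (-(1 / 2ħ) ⟨x, Qₙ x⟩)`, as an element of the
Schwartz space `𝓢(ℝⁿ)`. -/
noncomputable def gaussianWindow {ħ : ℝ} (hħ : 0 < ħ) {q : ℕ → ℝ} (hq : ∀ j, 0 < q j) (n : ℕ) :
    𝓢(E n, ℂ) :=
  ((2 * Real.pi * ħ) ^ (-(n : ℝ) / 2)) •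
    SchwartzMap.postcompCLM (𝕜 := ℝ) Complex.ofRealCLM
      { toFun := fun x => Real.exp (-quadForm ħ q n x)
        smooth' := (quadForm_hasTemperateGrowth ħ q n).1.neg.exp
        decay' := fun k m => by
          obtain ⟨a, ha, h⟩ := exists_le_quadForm hħ hq n
          exact exp_neg_decay (quadForm_hasTemperateGrowth ħ q n) ha h k m }

theorem gaussianWindow_apply {ħ : ℝ} (hħ : 0 < ħ) {q : ℕ → ℝ} (hq : ∀ j, 0 < q j) (n : ℕ)
    (x : E n) :
    gaussianWindow hħ hq n x =
      ((2 * Real.pi * ħ) ^ (-(n : ℝ) / 2) *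
        Real.exp (-(1 / (2 * ħ) * ∑ j : Fin n, q j * x j ^ 2)) : ℝ) := by
  rw [Complex.ofReal_mul]
  rfl

/-- The phase space shift `π(x, ξ) g = M_ξ T_x g`. -/
noncomputable def phaseShift (ħ : ℝ) {n : ℕ} (x ξ : E n) (g : 𝓢(E n, ℂ)) : 𝓢(E n, ℂ) :=
  SchwartzMap.smulLeftCLM ℂ
    (fun y : E n => (((2 * Real.pi * ħ) ^ (-(n : ℝ) / 2) : ℝ) : ℂ) *
      Complex.exp (Complex.I / ħ * (inner ℝ ξ y : ℝ)))
    (SchwartzMap.compSubConstCLM ℂ x g)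

theorem phaseShift_apply (ħ : ℝ) {n : ℕ} (x ξ : E n) (g : 𝓢(E n, ℂ)) (y : E n) :
    phaseShift ħ x ξ g y = (((2 * Real.pi * ħ) ^ (-(n : ℝ) / 2) : ℝ) : ℂ) *
      Complex.exp (Complex.I / ħ * (inner ℝ ξ y : ℝ)) * g (y - x) := by
  rw [phaseShift, SchwartzMap.smulLeftCLM_apply_apply (hasTemperateGrowth_wave ħ _ ξ)]
  rfl

/-- Complex conjugation on the Schwartz space. -/
noncomputable def conjS {n : ℕ} (φ : 𝓢(E n, ℂ)) : 𝓢(E n, ℂ) :=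
  SchwartzMap.postcompCLM (𝕜 := ℝ) (Complex.conjCLE : ℂ →L[ℝ] ℂ) φ

theorem conjS_apply {n : ℕ} (φ : 𝓢(E n, ℂ)) (y : E n) :
    conjS φ y = (starRingEnd ℂ) (φ y) := rfl

/-- The short-time Fourier transform `V_g u (x, ξ) = ⟨u, π(x, ξ) g⟩` of a temperate distribution,
where `⟨u, φ⟩ = u (conj φ)`. -/
noncomputable def stft (ħ : ℝ) {n : ℕ} (g : 𝓢(E n, ℂ)) (u : 𝓢'(E n, ℂ)) (x ξ : E n) : ℂ :=
  u (conjS (phaseShift ħ x ξ g))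

/-! ### The Sjöstrand class -/

/-- `‖u‖_{M^{∞,1}_{(g)}} = ∫ sup_x |V_g u (x, ξ)| dξ`, possibly infinite. -/
noncomputable def sjNorm (ħ : ℝ) {n : ℕ} (g : 𝓢(E n, ℂ)) (u : 𝓢'(E n, ℂ)) : ℝ≥0∞ :=
  ∫⁻ ξ : E n, ⨆ x : E n, ‖stft ħ g u x ξ‖ₑ

/-- The Sjöstrand class `M^{∞,1}(ℝⁿ)`: temperate distributions whose norm is finite for some
non-zero window. -/
def sjostrandClass (ħ : ℝ) (n : ℕ) : Set 𝓢'(E n, ℂ) :=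
  {u | ∃ g : 𝓢(E n, ℂ), g ≠ 0 ∧ sjNorm ħ g u < ⊤}

/-- The distribution `u` is (given by) the continuous function `f`. Every element of `M^{∞,1}(ℝⁿ)`
is of this form for exactly one `f`. -/
def IsGivenBy {n : ℕ} (u : 𝓢'(E n, ℂ)) (f : E n → ℂ) : Prop :=
  Continuous f ∧ ∀ φ : 𝓢(E n, ℂ), Integrable (fun y => φ y * f y) ∧ u φ = ∫ y, φ y * f y

/-! ### Cylinder functions on the space of real sequences -/

/-- The projection `πₙ : ℝ^∞ → ℝⁿ` onto the first `n` coordinates. -/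
noncomputable def proj (n : ℕ) (x : ℕ → ℝ) : E n := WithLp.toLp 2 fun j : Fin n => x j

/-- The extension map `𝓔ₙ`. -/
noncomputable def extend (n : ℕ) (f : E n → ℂ) : (ℕ → ℝ) → ℂ := fun x => f (proj n x)

/-- `F = 𝓔ₙ f`, where `f` is the continuous function that gives `u ∈ M^{∞,1}(ℝⁿ)`. -/
def IsCylRep (ħ : ℝ) (F : (ℕ → ℝ) → ℂ) (n : ℕ) (u : 𝓢'(E n, ℂ)) : Prop :=
  u ∈ sjostrandClass ħ n ∧ ∃ f : E n → ℂ, IsGivenBy u f ∧ F = extend n f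

/-- The set `𝓒₀ = ⋃ₙ 𝓔ₙ M^{∞,1}(ℝⁿ)`. -/
def cylinder (ħ : ℝ) : Set ((ℕ → ℝ) → ℂ) := {F | ∃ n u, IsCylRep ħ F n u}

/-- The norm of a cylinder function `F = 𝓔ₙ f`, which is the norm of `f` in
`M^{∞,1}_{(gₙ)}(ℝⁿ)`. All representations of `F` as a cylinder function give the same value, so
that the infimum over them is this common value (and it is `∞` outside of `𝓒₀`). -/
noncomputable def cylNorm {ħ : ℝ} (hħ : 0 < ħ) {q : ℕ → ℝ} (hq : ∀ j, 0 < q j)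
    (F : (ℕ → ℝ) → ℂ) : ℝ≥0∞ :=
  ⨅ (n : ℕ) (u : 𝓢'(E n, ℂ)) (_ : IsCylRep ħ F n u), sjNorm ħ (gaussianWindow hħ hq n) u

/-! ### The closure of the cylinder functions -/

/-- Cauchy sequences of cylinder functions. -/
def IsCylCauchy {ħ : ℝ} (hħ : 0 < ħ) {q : ℕ → ℝ} (hq : ∀ j, 0 < q j)
    (s : ℕ → (ℕ → ℝ) → ℂ) : Prop :=
  (∀ n, s n ∈ cylinder ħ) ∧
    ∀ ε : ℝ≥0∞, 0 < ε → ∃ N, ∀ m ≥ N, ∀ n ≥ N, cylNorm hħ hq (s m - s n) < ε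

/-- Two sequences of cylinder functions are equivalent if the norm of their difference tends to
zero. -/
def CylEquiv {ħ : ℝ} (hħ : 0 < ħ) {q : ℕ → ℝ} (hq : ∀ j, 0 < q j)
    (s t : ℕ → (ℕ → ℝ) → ℂ) : Prop :=
  Tendsto (fun n => cylNorm hħ hq (s n - t n)) atTop (𝓝 0)

/-- The domain `D(L)`, that is, the (abstract) closure of `𝓒₀` in its norm: its elements are the
equivalence classes of Cauchy sequences of cylinder functions. -/
def domainL {ħ : ℝ} (hħ : 0 < ħ) {q : ℕ → ℝ} (hq : ∀ j, 0 < q j) :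
    Set (Set (ℕ → (ℕ → ℝ) → ℂ)) :=
  {f | ∃ s, IsCylCauchy hħ hq s ∧ f = {t | IsCylCauchy hħ hq t ∧ CylEquiv hħ hq t s}}

end Fresnel

open scoped FourierTransform

namespace Fresnel

/-! The norm dominates the supremum norm with constant `1` in every dimension, so Cauchy sequences
of cylinder functions converge at each point, and equivalent ones have the same limit. For the
bound, fix `x` and put `h y = conj (g (y - x)) * f y`. Up to a constant and a dilation, `V_g u (x,
·)` is the Fourier transform of `h`. Fourier inversion at `x` gives `|f x| |g 0| = |h x| ≤ ∫ |𝓕 h|`,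
and the integral is at most `(2πħ)^(-n/2)` times the norm of `u`
(`enorm_mul_enorm_window_le_sjNorm`). The Gaussian window has `gₙ(0) = (2πħ)^(-n/2)`, so the
dimensional factors cancel. -/

theorem enorm_ofReal_of_nonneg {r : ℝ} (hr : 0 ≤ r) : ‖(r : ℂ)‖ₑ = ENNReal.ofReal r := by
  rw [← ofReal_norm, Complex.norm_of_nonneg hr]

/-- The short-time Fourier transform as the Fourier transform of `f` times a shifted window. -/
theorem stft_eq_fourier {ħ : ℝ} (hħ : 0 < ħ) {n : ℕ} (g : 𝓢(E n, ℂ)) {u : 𝓢'(E n, ℂ)}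
    {f : E n → ℂ} (hu : IsGivenBy u f) (x ξ : E n) :
    stft ħ g u x ξ = (((2 * Real.pi * ħ) ^ (-(n : ℝ) / 2) : ℝ) : ℂ) *
      𝓕 (fun y : E n => (starRingEnd ℂ) (g (y - x)) * f y) ((2 * Real.pi * ħ)⁻¹ • ξ) := by
  rw [stft, (hu.2 _).2, Real.fourier_eq', ← integral_const_mul]
  congr 1 with y
  rw [conjS_apply, phaseShift_apply, map_mul, map_mul, Complex.conj_ofReal, ← Complex.exp_conj,
    smul_eq_mul, inner_smul_right, real_inner_comm]
  -- Conjugating the plane wave gives the Fourier kernel `exp (-2πi ⟨y, w⟩)` at the frequency `w = ξ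
  -- / (2πħ)`.
  have he : (starRingEnd ℂ) (Complex.I / ħ * (inner ℝ y ξ : ℝ)) =
      ((-2 * Real.pi * ((2 * Real.pi * ħ)⁻¹ * inner ℝ y ξ) : ℝ) : ℂ) * Complex.I := by
    rw [map_mul, map_div₀, Complex.conj_I, Complex.conj_ofReal, Complex.conj_ofReal]
    push_cast
    have h1 : (Real.pi : ℂ) ≠ 0 := by exact_mod_cast Real.pi_ne_zero
    have h2 : (ħ : ℂ) ≠ 0 := by exact_mod_cast hħ.ne'
    field_simp
  rw [he]
  ring

/-- The conjugate of a translated window is itself a Schwartz function, so `IsGivenBy` already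
contains this; no bound on `f` is needed. -/
theorem integrable_conj_window_mul {n : ℕ} (g : 𝓢(E n, ℂ)) {u : 𝓢'(E n, ℂ)} {f : E n → ℂ}
    (hu : IsGivenBy u f) (x : E n) :
    Integrable (fun y : E n => (starRingEnd ℂ) (g (y - x)) * f y) :=
  (hu.2 (conjS (SchwartzMap.compSubConstCLM ℂ x g))).1

theorem lintegral_comp_inv_smul {n : ℕ} {c : ℝ} (hc : 0 < c) (F : E n → ℝ≥0∞) :
    ∫⁻ ξ : E n, F (c⁻¹ • ξ) = ENNReal.ofReal (c ^ n) * ∫⁻ w : E n, F w := by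
  have he : MeasurableEmbedding (fun ξ : E n => c⁻¹ • ξ) :=
    (Homeomorph.smulOfNeZero c⁻¹ (inv_ne_zero hc.ne')).measurableEmbedding
  rw [← he.lintegral_map F, Measure.map_addHaar_smul volume (inv_ne_zero hc.ne'),
    lintegral_smul_measure]
  simp [abs_of_pos hc]

/-- The pointwise bound by the norm of the Sjöstrand class, for an arbitrary window. -/
theorem enorm_mul_enorm_window_le_sjNorm {ħ : ℝ} (hħ : 0 < ħ) {n : ℕ} (g : 𝓢(E n, ℂ))
    {u : 𝓢'(E n, ℂ)} {f : E n → ℂ} (hu : IsGivenBy u f) (x : E n) :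
    ‖f x‖ₑ * ‖g 0‖ₑ ≤
      ENNReal.ofReal ((2 * Real.pi * ħ) ^ (-(n : ℝ) / 2)) * sjNorm ħ g u := by
  set c : ℝ := 2 * Real.pi * ħ with hc_def
  have hc : 0 < c := by positivity
  set a : ℝ := c ^ (-(n : ℝ) / 2) with ha_def
  have ha : 0 < a := Real.rpow_pos_of_pos hc _
  -- One `a` normalises the modulation and `c ^ n` is the Jacobian of `ξ ↦ c⁻¹ • ξ`; multiplying by
  -- a further `a` isolates `∫ |𝓕 h|`.
  have haa : a * a * c ^ n = 1 := by
    rw [ha_def, ← Real.rpow_natCast, ← Real.rpow_add hc, ← Real.rpow_add hc]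
    ring_nf
    exact Real.rpow_zero c
  set h : E n → ℂ := fun y => (starRingEnd ℂ) (g (y - x)) * f y with hh
  have hint : Integrable h := integrable_conj_window_mul g hu x
  have hcont : Continuous h :=
    (Complex.continuous_conj.comp (g.continuous.comp (continuous_id.sub continuous_const))).mul hu.1
  have hstft : ∀ ξ, ‖stft ħ g u x ξ‖ₑ = ENNReal.ofReal a * ‖𝓕 h (c⁻¹ • ξ)‖ₑ := fun ξ => by
    rw [stft_eq_fourier hħ g hu, enorm_mul]
    congr 1
    exact enorm_ofReal_of_nonneg ha.le
  have hnorm : ∫⁻ w, ‖𝓕 h w‖ₑ ≤ ENNReal.ofReal a * sjNorm ħ g u := by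
    have h1 : ENNReal.ofReal a * (ENNReal.ofReal (c ^ n) * ∫⁻ w, ‖𝓕 h w‖ₑ) ≤ sjNorm ħ g u := by
      rw [← lintegral_comp_inv_smul hc fun w => ‖𝓕 h w‖ₑ,
        ← lintegral_const_mul' _ _ ENNReal.ofReal_ne_top, sjNorm]
      refine lintegral_mono fun ξ => ?_
      rw [← hstft]
      exact le_iSup (fun x => ‖stft ħ g u x ξ‖ₑ) x
    calc ∫⁻ w, ‖𝓕 h w‖ₑ
        = ENNReal.ofReal a * (ENNReal.ofReal a * (ENNReal.ofReal (c ^ n) * ∫⁻ w, ‖𝓕 h w‖ₑ)) := by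
          rw [← mul_assoc, ← mul_assoc, ← ENNReal.ofReal_mul ha.le,
            ← ENNReal.ofReal_mul (by positivity), haa, ENNReal.ofReal_one, one_mul]
      _ ≤ _ := by gcongr
  refine le_trans ?_ hnorm
  -- Inversion needs `𝓕 h` integrable; otherwise the right side is infinite and the bound is
  -- trivial.
  by_cases htop : ∫⁻ w, ‖𝓕 h w‖ₑ = ⊤
  · rw [htop]; exact le_top
  have hFcont : Continuous (𝓕 h) :=
    VectorFourier.fourierIntegral_continuous Real.continuous_fourierChar continuous_inner hint
  have hFint : Integrable (𝓕 h) :=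
    ⟨hFcont.aestronglyMeasurable, lt_top_iff_ne_top.2 htop⟩
  have hinv := hint.fourierInv_fourier_eq hFint (v := x) hcont.continuousAt
  have hx : ‖h x‖ₑ = ‖f x‖ₑ * ‖g 0‖ₑ := by
    simp [hh, enorm_mul, mul_comm]
  rw [← hx, ← hinv, Real.fourierInv_eq']
  refine (enorm_integral_le_lintegral_enorm _).trans (lintegral_mono fun w => ?_)
  rw [enorm_smul, ← ofReal_norm (Complex.exp _), Complex.norm_exp_ofReal_mul_I,
    ENNReal.ofReal_one, one_mul]

/-- With Gaussian windows the pointwise bound holds with the constant `1` in every dimension. -/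
theorem enorm_le_sjNorm_gaussianWindow {ħ : ℝ} (hħ : 0 < ħ) {q : ℕ → ℝ} (hq : ∀ j, 0 < q j)
    {n : ℕ} {u : 𝓢'(E n, ℂ)} {f : E n → ℂ} (hu : IsGivenBy u f) (x : E n) :
    ‖f x‖ₑ ≤ sjNorm ħ (gaussianWindow hħ hq n) u := by
  have h := enorm_mul_enorm_window_le_sjNorm hħ (gaussianWindow hħ hq n) hu x
  have ha : 0 < (2 * Real.pi * ħ) ^ (-(n : ℝ) / 2) := Real.rpow_pos_of_pos (by positivity) _
  have hg : ‖gaussianWindow hħ hq n 0‖ₑ =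
      ENNReal.ofReal ((2 * Real.pi * ħ) ^ (-(n : ℝ) / 2)) := by
    rw [gaussianWindow_apply, enorm_ofReal_of_nonneg (mul_nonneg ha.le (Real.exp_nonneg _))]
    simp
  rw [hg, mul_comm] at h
  exact (ENNReal.mul_le_mul_iff_right (ENNReal.ofReal_pos.2 ha).ne' ENNReal.ofReal_ne_top).1 h

/-- Cylinder functions are bounded pointwise by their norm. -/
theorem enorm_le_cylNorm {ħ : ℝ} (hħ : 0 < ħ) {q : ℕ → ℝ} (hq : ∀ j, 0 < q j)
    (F : (ℕ → ℝ) → ℂ) (x : ℕ → ℝ) : ‖F x‖ₑ ≤ cylNorm hħ hq F := by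
  -- Every representation of `F` obeys the bound, so their norms need not be compared; without any,
  -- the infimum is `⊤`.
  refine le_iInf fun n => le_iInf fun u => le_iInf fun hu => ?_
  obtain ⟨-, f, hf, rfl⟩ := hu
  exact enorm_le_sjNorm_gaussianWindow hħ hq hf _

theorem IsCylCauchy.exists_tendsto {ħ : ℝ} {hħ : 0 < ħ} {q : ℕ → ℝ} {hq : ∀ j, 0 < q j}
    {s : ℕ → (ℕ → ℝ) → ℂ} (hs : IsCylCauchy hħ hq s) (x : ℕ → ℝ) :
    ∃ z : ℂ, Tendsto (fun n => s n x) atTop (𝓝 z) := by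
  refine cauchySeq_tendsto_of_complete (EMetric.cauchySeq_iff.2 fun ε hε => ?_)
  obtain ⟨N, hN⟩ := hs.2 ε hε
  refine ⟨N, fun m hm n hn => ?_⟩
  rw [edist_eq_enorm_sub]
  exact (enorm_le_cylNorm hħ hq (s m - s n) x).trans_lt (hN m hm n hn)

theorem CylEquiv.tendsto_sub {ħ : ℝ} {hħ : 0 < ħ} {q : ℕ → ℝ} {hq : ∀ j, 0 < q j}
    {s t : ℕ → (ℕ → ℝ) → ℂ} (h : CylEquiv hħ hq s t) (x : ℕ → ℝ) :
    Tendsto (fun n => s n x - t n x) atTop (𝓝 0) :=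
  tendsto_zero_iff_enorm_tendsto_zero.2 <|
    tendsto_of_tendsto_of_tendsto_of_le_of_le tendsto_const_nhds h (fun _ => zero_le)
      fun n => enorm_le_cylNorm hħ hq (s n - t n) x

/-- The Cauchy condition with `m = n` gives this. It puts a representative into its own class, which
is what makes the limit function unique. -/
theorem IsCylCauchy.cylEquiv_refl {ħ : ℝ} {hħ : 0 < ħ} {q : ℕ → ℝ} {hq : ∀ j, 0 < q j}
    {s : ℕ → (ℕ → ℝ) → ℂ} (hs : IsCylCauchy hħ hq s) : CylEquiv hħ hq s s :=
  ENNReal.tendsto_nhds_zero.2 fun ε hε =>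
    let ⟨N, hN⟩ := hs.2 ε hε
    eventually_atTop.2 ⟨N, fun n hn => (hN n hn n hn).le⟩

end Fresnel

theorem corollary5p6 {ħ : ℝ} (hħ : 0 < ħ) (_hħ1 : ħ ≤ 1) {q : ℕ → ℝ} (hq : ∀ j, 0 < q j)
    (_hq2 : Summable fun j => q j ^ 2) :
    ∀ f ∈ Fresnel.domainL hħ hq,
      (∀ s ∈ f, ∀ x : ℕ → ℝ, ∃ z : ℂ, Tendsto (fun n => s n x) atTop (𝓝 z)) ∧
      (∀ s ∈ f, ∀ t ∈ f, ∀ (x : ℕ → ℝ) (z w : ℂ), Tendsto (fun n => s n x) atTop (𝓝 z) →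
        Tendsto (fun n => t n x) atTop (𝓝 w) → z = w) ∧
      ∃! F : (ℕ → ℝ) → ℂ, ∀ s ∈ f, ∀ x : ℕ → ℝ, Tendsto (fun n => s n x) atTop (𝓝 (F x)) := by
  rintro f ⟨r, hr, rfl⟩
  choose F hF using hr.exists_tendsto
  have hlim : ∀ s ∈ {t | Fresnel.IsCylCauchy hħ hq t ∧ Fresnel.CylEquiv hħ hq t r},
      ∀ x : ℕ → ℝ, Tendsto (fun n => s n x) atTop (𝓝 (F x)) := fun s hs x => by
    -- Write `s n x = (s n x - r n x) + r n x`, where the difference tends to zero.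
    simpa using (hs.2.tendsto_sub x).add (hF x)
  refine ⟨fun s hs x => ⟨F x, hlim s hs x⟩, fun s hs t ht x z w hz hw => ?_, F, hlim,
    fun G hG => funext fun x => ?_⟩
  · exact (tendsto_nhds_unique hz (hlim s hs x)).trans (tendsto_nhds_unique (hlim t ht x) hw)
  · exact tendsto_nhds_unique (hG r ⟨hr, hr.cylEquiv_refl⟩ x) (hF x)
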